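/- Let $\mathfrak{o}$ be a compact discrete valuation ring with uniformizer $\pi$ and finite residue field, let $r\ge 2$, $\ell=\lceil r/2\rceil$, $\ell'=\lfloor r/2\rfloor$, and write $\mathfrak{o}_i=\mathfrak{o}/\pi^i\mathfrak{o}$. Fix an additive character $\psi:\mathfrak{o}_r\to\mathbb{C}^\times$ with $\psi(\pi^{r-1})\neq 1$. Let $A=\begin{pmatrix}0&a^{-1}\alpha\\ a&\beta\end{pmatrix}\in M_2(\mathfrak{o}_{\ell'})$ with $a\in\mathfrak{o}_{\ell'}^\times$, and let $\tilde A=\begin{pmatrix}0&\tilde a^{-1}\tilde\alpha\\ \tilde a&\tilde\beta\end{pmatrix}\in M_2(\mathfrak{o}_r)$, where $\tilde a,\tilde\alpha,\tilde\beta\in\mathfrak{o}_r$ are lifts of $a,\alpha,\beta$. For $i\le r$ let $M^i$ and $K^i$ be the kernels of $\mathrm{GL}_2(\mathfrak{o}_r)\to\mathrm{GL}_2(\mathfrak{o}_i)$ and $\mathrm{SL}_2(\mathfrak{o}_r)\to\mathrm{SL}_2(\mathfrak{o}_i)$. Let $\psi_A$ be the character $I+\pi^\ell B\mapsto\psi(\pi^\ell\,\mathrm{trace}(\tilde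 A B))$ of $M^\ell$ (it depends only on $A$), and $\psi_{[A]}=\psi_A|_{K^\ell}$. Put $$D_S^\ell(\tilde A)=\big((C_{\mathrm{GL}_2(\mathfrak{o}_r)}(\tilde A)\cap M^1)\,M^\ell\big)\cap\mathrm{SL}_2(\mathfrak{o}_r),\qquad e_\lambda=\begin{pmatrix}1&\tilde a^{-1}\lambda\\0&1\end{pmatrix},$$ $$\mathrm{h}_{\tilde A}^{\ell'}=\{x\in\mathfrak{o}_r: 2x\equiv 0,\ x(x+\tilde\beta)\equiv 0 \bmod \pi^{\ell'}\},$$ $$E'_{\tilde A}=\{\lambda\in\mathrm{h}_{\tilde A}^{\ell'}:\psi_{[A]}\text{ extends to a one-dimensional representation of } D_S^\ell(\tilde A)\langle e_\lambda\rangle\}.$$ With $f(\lambda,x,y)=xy\lambda(\tilde\beta-\lambda)-\tilde\alpha\lambda y^2+\lambda(x^2-1)$ and $g(x,y)=x^2+\tilde\beta xy-\tilde\alpha y^2$, put $$E'_{\lambda,\tilde A}=\{(x,y)\in\mathfrak{o}_r\times\pi\mathfrak{o}_r: g(x,y)\equiv 1\bmod\pi^\ell,\ \lambda y\in\pi^\ell\mathfrak{o}_r\},\qquad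 E'^{\circ}_{\lambda,\tilde A}=\{(x,y)\in E'_{\lambda,\tilde A}:\psi(f(\lambda,x,y))=1\}.$$ Then for every $\lambda\in\mathrm{h}_{\tilde A}^{\ell'}$ the following are equivalent, where $[g,h]=ghg^{-1}h^{-1}$: 1. $E'_{\lambda,\tilde A}=E'^{\circ}_{\lambda,\tilde A}$. 2. Every element of $K^\ell$ of the form $[e_\lambda,X]$ with $X\in D_S^\ell(\tilde A)$ lies in the kernel of $\psi_{[A]}$. 3. $[\langle e_\lambda\rangle,D_S^\ell(\tilde A)]\cap K^\ell$ is contained in the kernel of $\psi_{[A]}$, where $[\langle e_\lambda\rangle,D_S^\ell(\tilde A)]$ is the subgroup generated by the commutators. 4. $\lambda\in E'_{\tilde A}$, i.e. there exists an extension of $\psi_{[A]}$ to $D_S^\ell(\tilde A)\langle e_\lambda\rangle$. -/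

import Mathlib

namespace SLTwoExt

open Matrix

noncomputable section

/-- The finite quotient `𝔬_n = 𝔬 / ℘ ^ n` of a local ring `𝔬` with maximal ideal `℘`. -/
abbrev Oq (𝔬 : Type*) [CommRing 𝔬] [IsLocalRing 𝔬] (n : ℕ) : Type _ :=
  𝔬 ⧸ (IsLocalRing.maximalIdeal 𝔬) ^ n

/-- `ℓ = ⌈r / 2⌉`. -/
def ell (r : ℕ) : ℕ := (r + 1) / 2

/-- `ℓ' = ⌊r / 2⌋`. -/
def ell' (r : ℕ) : ℕ := r / 2

theorem ell_le (r : ℕ) : ell r ≤ r := by unfold ell; omega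

theorem ell'_le (r : ℕ) : ell' r ≤ r := by unfold ell'; omega

theorem le_ell_add_ell (r : ℕ) : r ≤ ell r + ell r := by unfold ell; omega

theorem le_ell'_add_ell (r : ℕ) : r ≤ ell' r + ell r := by unfold ell ell'; omega

section Groups

variable {𝔬 : Type*} [CommRing 𝔬] [IsLocalRing 𝔬]

/-- The natural ring homomorphism `𝔬_r → 𝔬_i` for `i ≤ r`. -/
def red {r i : ℕ} (h : i ≤ r) : Oq 𝔬 r →+* Oq 𝔬 i :=
  Ideal.Quotient.factor (Ideal.pow_le_pow_right h)

theorem red_surjective {r i : ℕ} (h : i ≤ r) :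
    Function.Surjective (red (𝔬 := 𝔬) h) :=
  Ideal.Quotient.factor_surjective _

theorem mul_eq_zero_of_red {r i j : ℕ} (hi : i ≤ r) (hj : j ≤ r) (hij : r ≤ i + j)
    {x y : Oq 𝔬 r} (hx : red hi x = 0) (hy : red hj y = 0) : x * y = 0 := by
  obtain ⟨x, rfl⟩ := Ideal.Quotient.mk_surjective x
  obtain ⟨y, rfl⟩ := Ideal.Quotient.mk_surjective y
  rw [red, Ideal.Quotient.factor_mk, Ideal.Quotient.eq_zero_iff_mem] at hx hy
  rw [← map_mul, Ideal.Quotient.eq_zero_iff_mem]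
  refine Ideal.pow_le_pow_right hij ?_
  rw [pow_add]
  exact Ideal.mul_mem_mul hx hy

/-- The congruence subgroup `M^i = Ker (GL₂(𝔬_r) → GL₂(𝔬_i))`. -/
def congM {r i : ℕ} (h : i ≤ r) : Subgroup (GL (Fin 2) (Oq 𝔬 r)) :=
  (GeneralLinearGroup.map (n := Fin 2) (red (𝔬 := 𝔬) h)).ker

/-- The congruence subgroup `K^i = Ker (SL₂(𝔬_r) → SL₂(𝔬_i))`. -/
def congK {r i : ℕ} (h : i ≤ r) : Subgroup (SpecialLinearGroup (Fin 2) (Oq 𝔬 r)) :=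
  (SpecialLinearGroup.map (n := Fin 2) (red (𝔬 := 𝔬) h)).ker

theorem red_sub_one_of_mem_congM {r i : ℕ} (h : i ≤ r) {g : GL (Fin 2) (Oq 𝔬 r)}
    (hg : g ∈ congM h) (s t : Fin 2) : red h (((g : Matrix (Fin 2) (Fin 2) (Oq 𝔬 r)) - 1) s t) = 0 := by
  have h1 : GeneralLinearGroup.map (n := Fin 2) (red (𝔬 := 𝔬) h) g = 1 := hg
  have h2 := congrArg (fun u : GL (Fin 2) (Oq 𝔬 i) => (u : Matrix (Fin 2) (Fin 2) (Oq 𝔬 i)) s t) h1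
  simp only [GeneralLinearGroup.map_apply, Units.val_one] at h2
  rw [Matrix.sub_apply, map_sub, h2, one_apply, one_apply]
  split_ifs <;> simp

theorem toGL_mem_congM {r i : ℕ} (h : i ≤ r) {g : SpecialLinearGroup (Fin 2) (Oq 𝔬 r)}
    (hg : g ∈ congK h) : SpecialLinearGroup.toGL g ∈ congM h := by
  have h1 : SpecialLinearGroup.map (n := Fin 2) (red (𝔬 := 𝔬) h) g = 1 := hg
  change GeneralLinearGroup.map (n := Fin 2) (red (𝔬 := 𝔬) h) _ = 1
  ext s t
  have h2 := congrArg (fun u : SpecialLinearGroup (Fin 2) (Oq 𝔬 i) => (u : Matrix (Fin 2) (Fin 2) (Oq 𝔬 i)) s t) h1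
  simpa using h2

/-- The centralizer in `GL₂(R)` of a matrix `X ∈ M₂(R)`. -/
def centGL {R : Type*} [CommRing R] (X : Matrix (Fin 2) (Fin 2) R) :
    Subgroup (GL (Fin 2) R) where
  carrier := {g | Commute (g : Matrix (Fin 2) (Fin 2) R) X}
  mul_mem' := fun {g h} hg hh => by
    change Commute ((g * h : GL (Fin 2) R) : Matrix (Fin 2) (Fin 2) R) X
    rw [Units.val_mul]
    exact Commute.mul_left hg hh
  one_mem' := by
    change Commute ((1 : GL (Fin 2) R) : Matrix (Fin 2) (Fin 2) R) X
    rw [Units.val_one]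
    exact Commute.one_left X
  inv_mem' := fun {g} hg => Commute.units_inv_left hg

/-- `D_G^ℓ(X) = (C_{GL₂(𝔬_r)}(X) ∩ M^1) M^ℓ`; the join is the product because `M^ℓ` is normal. -/
def DG {r : ℕ} (hr : 2 ≤ r) (X : Matrix (Fin 2) (Fin 2) (Oq 𝔬 r)) :
    Subgroup (GL (Fin 2) (Oq 𝔬 r)) :=
  (centGL X ⊓ congM (show 1 ≤ r by omega)) ⊔ congM (ell_le r)

/-- `D_S^ℓ(X) = D_G^ℓ(X) ∩ SL₂(𝔬_r)`, as a subgroup of `SL₂(𝔬_r)`. -/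
def DS {r : ℕ} (hr : 2 ≤ r) (X : Matrix (Fin 2) (Fin 2) (Oq 𝔬 r)) :
    Subgroup (SpecialLinearGroup (Fin 2) (Oq 𝔬 r)) :=
  (DG hr X).comap SpecialLinearGroup.toGL

/-- The character `g ↦ ψ (trace (X (g - I)))` of `M^ℓ`, that is
`I + π^ℓ B ↦ ψ (π^ℓ trace (X B))`, for `X ∈ M₂(𝔬_r)`. -/
def psiLift {r : ℕ} (ψ : AddChar (Oq 𝔬 r) ℂˣ) (X : Matrix (Fin 2) (Fin 2) (Oq 𝔬 r)) :
    congM (𝔬 := 𝔬) (ell_le r) →* ℂˣ where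
  toFun g := ψ (trace (X * (((g : GL (Fin 2) (Oq 𝔬 r)) : Matrix (Fin 2) (Fin 2) (Oq 𝔬 r)) - 1)))
  map_one' := by simp
  map_mul' g h := by
    have hz : ((((g : GL (Fin 2) (Oq 𝔬 r)) : Matrix (Fin 2) (Fin 2) (Oq 𝔬 r)) - 1) *
        (((h : GL (Fin 2) (Oq 𝔬 r)) : Matrix (Fin 2) (Fin 2) (Oq 𝔬 r)) - 1)) = 0 := by
      ext s t
      rw [Matrix.mul_apply, Matrix.zero_apply]
      exact Finset.sum_eq_zero fun k _ => mul_eq_zero_of_red (ell_le r) (ell_le r)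
        (le_ell_add_ell r) (red_sub_one_of_mem_congM _ g.2 _ _)
        (red_sub_one_of_mem_congM _ h.2 _ _)
    rw [← AddChar.map_add_eq_mul, ← trace_add, ← mul_add]
    congr 3
    rw [Subgroup.coe_mul, Units.val_mul, ← sub_eq_zero]
    rw [← hz]
    noncomm_ring

/-- The character `ψ_A` of `M^ℓ` attached to `A ∈ M₂(𝔬_{ℓ'})`, computed with some lift of `A`
to `M₂(𝔬_r)`; `psiA_apply` shows that every lift gives the same character. -/
def psiA {r : ℕ} (ψ : AddChar (Oq 𝔬 r) ℂˣ) (A : Matrix (Fin 2) (Fin 2) (Oq 𝔬 (ell' r))) :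
    congM (𝔬 := 𝔬) (ell_le r) →* ℂˣ :=
  psiLift ψ (A.map (Function.surjInv (red_surjective (𝔬 := 𝔬) (ell'_le r))))

theorem psiA_eq_psiLift {r : ℕ} (ψ : AddChar (Oq 𝔬 r) ℂˣ)
    (A : Matrix (Fin 2) (Fin 2) (Oq 𝔬 (ell' r))) (X : Matrix (Fin 2) (Fin 2) (Oq 𝔬 r))
    (hX : X.map (red (ell'_le r)) = A) : psiA ψ A = psiLift ψ X := by
  ext1 g
  change ψ _ = ψ _
  congr 1
  rw [← sub_eq_zero, ← trace_sub, ← sub_mul]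
  refine (congrArg trace (?_ : _ = (0 : Matrix (Fin 2) (Fin 2) (Oq 𝔬 r)))).trans (trace_zero _ _)
  ext s t
  rw [Matrix.mul_apply, Matrix.zero_apply]
  refine Finset.sum_eq_zero fun k _ => mul_eq_zero_of_red (ell'_le r) (ell_le r)
        (le_ell'_add_ell r) ?_ (red_sub_one_of_mem_congM _ g.2 _ _)
  have h1 := Function.surjInv_eq (red_surjective (𝔬 := 𝔬) (ell'_le r)) (A s k)
  have h2 : red (ell'_le r) (X s k) = A s k := congrFun (congrFun hX s) k
  have h3 : (A.map (Function.surjInv (red_surjective (𝔬 := 𝔬) (ell'_le r))) - X) s k =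
      Function.surjInv (red_surjective (𝔬 := 𝔬) (ell'_le r)) (A s k) - X s k := rfl
  rw [h3, map_sub, h1, h2, sub_self]

/-- `ψ_A (I + π^ℓ B) = ψ (π^ℓ trace (Ã B))` for every lift `Ã` of `A`. -/
theorem psiA_apply {r : ℕ} (ψ : AddChar (Oq 𝔬 r) ℂˣ)
    (A : Matrix (Fin 2) (Fin 2) (Oq 𝔬 (ell' r))) (X : Matrix (Fin 2) (Fin 2) (Oq 𝔬 r))
    (hX : X.map (red (ell'_le r)) = A) (g : congM (𝔬 := 𝔬) (ell_le r)) (ϖ : Oq 𝔬 r)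
    (B : Matrix (Fin 2) (Fin 2) (Oq 𝔬 r))
    (hg : ((g : GL (Fin 2) (Oq 𝔬 r)) : Matrix (Fin 2) (Fin 2) (Oq 𝔬 r)) = 1 + ϖ ^ ell r • B) :
    psiA ψ A g = ψ (ϖ ^ ell r * trace (X * B)) := by
  rw [psiA_eq_psiLift ψ A X hX]
  change ψ (trace (X * (((g : GL (Fin 2) (Oq 𝔬 r)) : Matrix (Fin 2) (Fin 2) (Oq 𝔬 r)) - 1))) = _
  rw [hg, add_sub_cancel_left, mul_smul_comm, trace_smul, smul_eq_mul]

/-- The character `ψ_[A]` of `K^ℓ`: the restriction of `ψ_A` to `K^ℓ = M^ℓ ∩ SL₂(𝔬_r)`. -/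
def psiBr {r : ℕ} (ψ : AddChar (Oq 𝔬 r) ℂˣ) (A : Matrix (Fin 2) (Fin 2) (Oq 𝔬 (ell' r))) :
    congK (𝔬 := 𝔬) (ell_le r) →* ℂˣ :=
  (psiA ψ A).comp ((SpecialLinearGroup.toGL.comp (congK (ell_le r)).subtype).codRestrict _
    fun g => toGL_mem_congM _ g.2)

end Groups

/-- A one-dimensional representation `χ` of a subgroup `K` extends to the subgroup `H ⊇ K`. -/
def ExtendsTo {G : Type*} [Group G] {K : Subgroup G} (χ : K →* ℂˣ) (H : Subgroup G) : Prop :=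
  ∃ h : K ≤ H, ∃ χ' : H →* ℂˣ, ∀ k : K, χ' (Subgroup.inclusion h k) = χ k

section Matrices

variable {R : Type*} [CommRing R]

/-- The matrix with rows `(0, a⁻¹ α)` and `(a, β)`. -/
def cycMat (a : Rˣ) (α β : R) : Matrix (Fin 2) (Fin 2) R :=
  !![0, (↑a⁻¹ : R) * α; (a : R), β]

/-- The matrix `e_x` with rows `(1, a⁻¹ x)` and `(0, 1)`, in `SL₂(R)`. -/
def eMat (a : Rˣ) (x : R) : SpecialLinearGroup (Fin 2) R :=
  ⟨!![1, (↑a⁻¹ : R) * x; 0, 1], by simp [det_fin_two]⟩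

/-- `h^i = {x | 2 x = 0 mod π^i and x (x + β) = 0 mod π^i}`. -/
def hSet (ϖ β : R) (i : ℕ) : Set R :=
  {x | 2 * x ∈ Ideal.span {ϖ ^ i} ∧ x * (x + β) ∈ Ideal.span {ϖ ^ i}}

/-- `f(λ, x, y)`, with `l` for `λ`. -/
def fPoly (α β l x y : R) : R := x * y * l * (β - l) - α * l * y ^ 2 + l * (x ^ 2 - 1)

/-- `g(x, y)`. -/
def gPoly (α β x y : R) : R := x ^ 2 + β * x * y - α * y ^ 2

/-- `{(x, y) ∈ R × πR | g(x, y) = 1 mod π^n and l y ∈ π^n R}`. -/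
def ESet (ϖ α β : R) (n : ℕ) (l : R) : Set (R × R) :=
  {p | p.2 ∈ Ideal.span {ϖ} ∧ gPoly α β p.1 p.2 - 1 ∈ Ideal.span {ϖ ^ n} ∧
    l * p.2 ∈ Ideal.span {ϖ ^ n}}

/-- The subset of `ESet` cut out by `ψ (f(l, x, y)) = 1`. -/
def ESetCirc (ψ : AddChar R ℂˣ) (ϖ α β : R) (n : ℕ) (l : R) : Set (R × R) :=
  {p | p ∈ ESet ϖ α β n l ∧ ψ (fPoly α β l p.1 p.2) = 1}

end Matrices

section Ext

variable {𝔬 : Type*} [CommRing 𝔬] [IsLocalRing 𝔬]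

/-- The group `D_S^ℓ(X) ⟨e⟩` generated by `D_S^ℓ(X)` and `e` (the product set, when `e`
normalizes `D_S^ℓ(X)`, as the elements `e_x` with `x ∈ h^{ℓ'}` do). -/
def DSgen {r : ℕ} (hr : 2 ≤ r) (X : Matrix (Fin 2) (Fin 2) (Oq 𝔬 r))
    (e : SpecialLinearGroup (Fin 2) (Oq 𝔬 r)) :
    Subgroup (SpecialLinearGroup (Fin 2) (Oq 𝔬 r)) :=
  DS hr X ⊔ Subgroup.zpowers e

/-- The set of the `e_x` in `H^{ℓ'} = {e_x | x ∈ h^{ℓ'}}` such that `ψ_[A]` extends to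
`D_S^ℓ(Ã) ⟨e_x⟩`, where `Ã` has the parameters `a, α, β`. -/
def EExtGrp {r : ℕ} (hr : 2 ≤ r) (ψ : AddChar (Oq 𝔬 r) ℂˣ) (ϖ : Oq 𝔬 r)
    (A : Matrix (Fin 2) (Fin 2) (Oq 𝔬 (ell' r))) (a : (Oq 𝔬 r)ˣ) (α β : Oq 𝔬 r) :
    Set (SpecialLinearGroup (Fin 2) (Oq 𝔬 r)) :=
  {e | e ∈ eMat a '' hSet ϖ β (ell' r) ∧ ExtendsTo (psiBr ψ A) (DSgen hr (cycMat a α β) e)}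

/-- `E'_Ã = {x ∈ h^{ℓ'} | e_x ∈ 𝔼'_Ã}`. -/
def EExt {r : ℕ} (hr : 2 ≤ r) (ψ : AddChar (Oq 𝔬 r) ℂˣ) (ϖ : Oq 𝔬 r)
    (A : Matrix (Fin 2) (Fin 2) (Oq 𝔬 (ell' r))) (a : (Oq 𝔬 r)ˣ) (α β : Oq 𝔬 r) :
    Set (Oq 𝔬 r) :=
  {x | x ∈ hSet ϖ β (ell' r) ∧ eMat a x ∈ EExtGrp hr ψ ϖ A a α β}

end Ext

end

end SLTwoExt

open SLTwoExt
open scoped commutatorElement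

/-!
Write `A` for the lift `cycMat a' α' β'`, `e` for `e_l`, `p` for `π ^ ℓ`, `D` for `D_S^ℓ(A)`
and `E'` for the set `ESet` of pairs `(x, y)`.

Since `a'` is a unit, the centralizer of `A` consists of the polynomials `x + y A`. Hence `X ∈ SL₂`
lies in `D` exactly when it is congruent modulo `p` to `x + y A`, where `x = X₀₀` and
`y = a'⁻¹ X₁₀`, and `x ≡ 1`, `y ≡ 0` modulo `π` (`mem_DS_iff`). Taking `x` and `y` from the first
column of `X` itself makes the rest explicit. The determinant condition gives `g(x, y) ≡ 1` modulo
`p`. The commutator `[e, X]` is in `K^ℓ` iff `p ∣ l y` (`commutator_eMat_mem_congK_iff`). The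
identity `trace (A ([e, X] - 1)) = f(l, x, y) + 2 l (1 - g(x, y))`, valid over every commutative
ring (`trace_cycMat_mul_commutator`), gives `ψ_[A]([e, X]) = ψ(f(l, x, y))`, because `2 l` is
divisible by `π ^ ℓ'` and `g(x, y) - 1` by `π ^ ℓ`. Conversely every `(x, y)` in `E'` with `x ≡ 1`
modulo `π` comes from some `X ∈ D` (`exists_mem_DS`). For the other points of `E'` one has
`x ≡ -1`, and `f` and `g` do not change when `(x, y)` is replaced by `(-x, -y)`. So the conditions
on `E'` and on the single commutators `[e, X]` are equivalent.

An extension of `ψ_[A]` to `D⟨e⟩` kills all commutators, hence `[⟨e⟩, D] ∩ K^ℓ`, hence the `[e, X]`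
in `K^ℓ`. The way back is `extendsTo_sup_zpowers`. The character `ψ_[A]` is trivial on `[D, D]`,
because the centralizer of `A` is commutative and fixes `ψ_A` (`commutator_DG_le`). As `e`
normalizes `D` (`eMat_mem_normalizer_DS`), `X ↦ [e, X]` is a homomorphism from `D` to its
abelianization, and the commutator subgroup of `D⟨e⟩` is contained in the subgroup
`S = {[e, X] n : X ∈ D, n ∈ [D, D]}`. If `ψ_[A]` is trivial on the `[e, X]`
in `K^ℓ`, it is trivial on `S ∩ K^ℓ`, so it factors through the image of `K^ℓ` in the
abelianization of `D⟨e⟩`, and a character of a subgroup of a finite abelian group extends to the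
whole group.
-/

namespace SLTwoExt

open Matrix
open scoped commutatorElement

/-! ### Extension of characters -/

section Characters

variable {G : Type*} [Group G]

/-- If the generators normalize `N` and commute modulo `N`, then the group they generate is abelian
modulo `N`. -/
theorem commutator_closure_le {N : Subgroup G} {T : Set G}
    (hT : T ⊆ Subgroup.normalizer (N : Set G)) (hN : ∀ s ∈ T, ∀ t ∈ T, ⁅s, t⁆ ∈ N) :
    ⁅Subgroup.closure T, Subgroup.closure T⁆ ≤ N := by
  have hle : Subgroup.closure T ≤ Subgroup.normalizer (N : Set G) := (Subgroup.closure_le _).2 hT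
  have key : ∀ x : G, (∀ t ∈ T, ⁅t, x⁆ ∈ N) → ∀ g ∈ Subgroup.closure T, ⁅g, x⁆ ∈ N := by
    intro x hx g hg
    induction hg using Subgroup.closure_induction with
    | mem t ht => exact hx t ht
    | one => simp
    | mul g h hg hh ihg ihh =>
      have h1 : ⁅g * h, x⁆ = g * ⁅h, x⁆ * g⁻¹ * ⁅g, x⁆ := by simp only [commutatorElement_def]; group
      rw [h1]
      exact mul_mem ((Subgroup.mem_normalizer_iff.1 (hle hg) _).1 ihh) ihg
    | inv g hg ihg =>
      have h1 : ⁅g⁻¹, x⁆ = g⁻¹ * ⁅g, x⁆⁻¹ * g⁻¹⁻¹ := by simp only [commutatorElement_def]; group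
      rw [h1]
      exact (Subgroup.mem_normalizer_iff.1 (inv_mem (hle hg)) _).1 (inv_mem ihg)
  rw [Subgroup.commutator_le]
  refine fun g hg h hh => key h (fun t ht => ?_) g hg
  rw [← commutatorElement_inv]
  exact inv_mem (key t (fun s hs => hN s hs t ht) h hh)

/-- Characters of a finite abelian group extend from subgroups, so a character of `K` extends to
`H` as soon as it factors through the image of `K` in the abelianization of `H`. -/
theorem extendsTo_of_commutator_inf_le [Finite G] {K H : Subgroup G} (hKH : K ≤ H) (χ : K →* ℂˣ)
    (hχ : ⁅H, H⁆ ⊓ K ≤ χ.ker.map K.subtype) : ExtendsTo χ H := by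
  let f : K →* Abelianization H := Abelianization.of.comp (Subgroup.inclusion hKH)
  have hf : f.ker ≤ χ.ker := by
    intro k hk
    have h1 : Subgroup.inclusion hKH k ∈ commutator H := by
      rw [← Abelianization.ker_of]; exact hk
    have h2 : (k : G) ∈ ⁅H, H⁆ := by
      have := Subgroup.mem_map_of_mem H.subtype h1
      rwa [Subgroup.map_subtype_commutator] at this
    obtain ⟨k', hk', h⟩ := hχ ⟨h2, k.2⟩
    rwa [← Subtype.ext h]
  let χ₁ : f.range →* ℂˣ := f.rangeRestrict.liftOfSurjective f.rangeRestrict_surjective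
    (⟨χ, by rwa [MonoidHom.ker_rangeRestrict]⟩ : {g : K →* ℂˣ // f.rangeRestrict.ker ≤ g.ker})
  obtain ⟨χ₂, h₂⟩ := MonoidHom.domRestrict_surjective (M := ℂ) f.range χ₁
  refine ⟨hKH, χ₂.comp Abelianization.of, fun k => ?_⟩
  have h3 : χ₁ (f.rangeRestrict k) = χ k :=
    MonoidHom.liftOfRightInverse_comp_apply _ _ _ _ _
  rw [← h3, ← h₂]
  rfl

theorem commutator_inf_le_of_extendsTo {K H D E : Subgroup G} {χ : K →* ℂˣ} (h : ExtendsTo χ H)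
    (hD : D ≤ H) (hE : E ≤ H) : ⁅E, D⁆ ⊓ K ≤ χ.ker.map K.subtype := by
  obtain ⟨hKH, χ', hχ'⟩ := h
  have h1 : ⁅E, D⁆ ≤ χ'.ker.map H.subtype := by
    rw [Subgroup.commutator_le]
    refine fun x hx y hy => ⟨⁅(⟨x, hE hx⟩ : H), (⟨y, hD hy⟩ : H)⁆, ?_, rfl⟩
    change χ' _ = 1
    rw [map_commutatorElement, commutatorElement_eq_one_iff_mul_comm, mul_comm]
  rintro k ⟨hk, hkK⟩
  obtain ⟨k', hk', rfl⟩ := h1 hk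
  exact ⟨⟨_, hkK⟩, (hχ' ⟨_, hkK⟩).symm.trans hk', rfl⟩

/-- The obstruction to extending a character `χ` of `K` to `D⟨e⟩`, where `e` normalizes `D` and `χ`
is trivial on `[D, D]`: it consists of the values of `χ` at those `[e, X]`, `X ∈ D`, that lie in
`K`. -/
theorem extendsTo_sup_zpowers [Finite G] {K D : Subgroup G} (hKD : K ≤ D)
    (χ : K →* ℂˣ) {e : G} (he : e ∈ Subgroup.normalizer (D : Set G))
    (hD : ⁅D, D⁆ ≤ χ.ker.map K.subtype)
    (heD : ∀ X ∈ D, ⁅e, X⁆ ∈ K → ⁅e, X⁆ ∈ χ.ker.map K.subtype) :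
    ExtendsTo χ (D ⊔ Subgroup.zpowers e) := by
  -- `X ↦ [e, X]` is multiplicative modulo `[D, D]`; `S` is the preimage in `D` of its range.
  let σ : D →* D := ((MulAut.conj e).toMonoidHom.comp D.subtype).codRestrict D
    fun X => (Subgroup.mem_normalizer_iff.1 he X).1 X.2
  let τ : D →* Abelianization D := Abelianization.of.comp σ / Abelianization.of
  let S : Subgroup G := (τ.range.comap Abelianization.of).map D.subtype
  have hτ : ∀ X : D, τ X = Abelianization.of (σ X * X⁻¹) := fun X => by
    rw [map_mul, map_inv, ← div_eq_mul_inv]; rfl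
  have hSD : S ≤ D := Subgroup.map_subtype_le _
  have hDS : ∀ X ∈ D, ∀ Y ∈ D, ⁅X, Y⁆ ∈ S := fun X hX Y hY =>
    ⟨⁅(⟨X, hX⟩ : D), (⟨Y, hY⟩ : D)⁆, ⟨1, by
      rw [map_one, map_commutatorElement, eq_comm, commutatorElement_eq_one_iff_mul_comm,
        mul_comm]⟩, rfl⟩
  have heS : ∀ X ∈ D, ⁅e, X⁆ ∈ S := fun X hX => ⟨σ ⟨X, hX⟩ * ⟨X, hX⟩⁻¹, ⟨⟨X, hX⟩, hτ _⟩, rfl⟩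
  have hSK : S ⊓ K ≤ χ.ker.map K.subtype := by
    rintro _ ⟨⟨s, ⟨X, hX⟩, rfl⟩, hsK⟩
    rw [hτ] at hX
    have h1 : (σ X * X⁻¹)⁻¹ * s ∈ commutator D := by
      rw [← Abelianization.ker_of, MonoidHom.mem_ker, map_mul, map_inv, hX, inv_mul_cancel]
    have h2 : ⁅e, (X : G)⁆⁻¹ * (s : G) ∈ χ.ker.map K.subtype := hD <| by
      have := Subgroup.mem_map_of_mem D.subtype h1
      rwa [Subgroup.map_subtype_commutator] at this
    have h3 : ⁅e, (X : G)⁆ = s * (⁅e, (X : G)⁆⁻¹ * (s : G))⁻¹ := by group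
    have h4 : ⁅e, (X : G)⁆ ∈ K := by
      rw [h3]; exact mul_mem hsK (inv_mem (Subgroup.map_subtype_le _ h2))
    have h5 : (s : G) = ⁅e, (X : G)⁆ * (⁅e, (X : G)⁆⁻¹ * (s : G)) := by group
    change (s : G) ∈ _
    rw [h5]
    exact mul_mem (heD X X.2 h4) h2
  have hconj : ∀ x s : G, x * s * x⁻¹ = ⁅x, s⁆ * s := fun x s => by
    rw [commutatorElement_def]; group
  have hH : D ⊔ Subgroup.zpowers e = Subgroup.closure ((D : Set G) ∪ {e}) := by
    rw [Subgroup.closure_union, Subgroup.closure_eq, Subgroup.zpowers_eq_closure]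
  have hle : ⁅D ⊔ Subgroup.zpowers e, D ⊔ Subgroup.zpowers e⁆ ≤ S := by
    rw [hH]
    refine commutator_closure_le ?_ ?_
    · have key : ∀ x ∈ (D : Set G) ∪ {e}, (∀ s, s ∈ D ↔ x * s * x⁻¹ ∈ D) ∧ ∀ s ∈ D, ⁅x, s⁆ ∈ S := by
        rintro x (hx | rfl)
        · exact ⟨Subgroup.mem_normalizer_iff.1 (Subgroup.le_normalizer hx), hDS x hx⟩
        · exact ⟨Subgroup.mem_normalizer_iff.1 he, heS⟩
      intro x hx
      obtain ⟨h1, h2⟩ := key x hx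
      rw [SetLike.mem_coe, Subgroup.mem_normalizer_iff]
      intro s
      constructor
      · intro hs
        rw [hconj]
        exact mul_mem (h2 s (hSD hs)) hs
      · intro hs
        have := h2 s ((h1 s).2 (hSD hs))
        rw [hconj] at hs
        exact (Subgroup.mul_mem_cancel_left _ this).1 hs
    · rintro x (hx | rfl) y (hy | rfl)
      · exact hDS x hx y hy
      · rw [← commutatorElement_inv]; exact inv_mem (heS x hx)
      · exact heS y hy
      · rw [commutatorElement_self]; exact one_mem _
  exact extendsTo_of_commutator_inf_le (hKD.trans le_sup_left) χ
    ((inf_le_inf_right K hle).trans hSK)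

end Characters

/-! ### The trace of `A ([e_l, X] - 1)` -/

section Trace

variable {R : Type*} [CommRing R]

theorem coe_commutator_eMat (a : Rˣ) (l : R) (X : SpecialLinearGroup (Fin 2) R) :
    ((⁅eMat a l, X⁆ : SpecialLinearGroup (Fin 2) R) : Matrix (Fin 2) (Fin 2) R) - 1 =
      (((eMat a l * X * (eMat a l)⁻¹ : SpecialLinearGroup (Fin 2) R) :
        Matrix (Fin 2) (Fin 2) R) - X) * (X⁻¹ : SpecialLinearGroup (Fin 2) R) := by
  rw [commutatorElement_def, sub_mul, ← Matrix.SpecialLinearGroup.coe_mul,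
    ← Matrix.SpecialLinearGroup.coe_mul,
    mul_inv_cancel, Matrix.SpecialLinearGroup.coe_one]

theorem eMat_conj (a : Rˣ) (l : R) (X : SpecialLinearGroup (Fin 2) R) :
    ((eMat a l * X * (eMat a l)⁻¹ : SpecialLinearGroup (Fin 2) R) : Matrix (Fin 2) (Fin 2) R) =
      !![X 0 0 + (↑a⁻¹ : R) * l * X 1 0,
        X 0 1 + (↑a⁻¹ : R) * l * (X 1 1 - X 0 0 - (↑a⁻¹ : R) * l * X 1 0);
        X 1 0, X 1 1 - (↑a⁻¹ : R) * l * X 1 0] := by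
  rw [Matrix.SpecialLinearGroup.coe_mul, Matrix.SpecialLinearGroup.coe_mul,
    Matrix.SpecialLinearGroup.coe_inv,
    adjugate_fin_two]
  ext i j
  fin_cases i <;> fin_cases j <;> simp [eMat, mul_apply, vecMul, dotProduct, Fin.sum_univ_two] <;> ring

/-- The value of `Y ↦ trace (A (Y - 1))` at `[e_l, X]`, without any congruence condition on `X` or
`l`: only `det X = 1` is used. -/
theorem trace_cycMat_mul_commutator (a : Rˣ) (α β l : R) (X : SpecialLinearGroup (Fin 2) R) :
    trace (cycMat a α β *
      (((⁅eMat a l, X⁆ : SpecialLinearGroup (Fin 2) R) : Matrix (Fin 2) (Fin 2) R) - 1)) =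
      fPoly α β l (X 0 0) ((↑a⁻¹ : R) * X 1 0) +
        2 * l * (1 - gPoly α β (X 0 0) ((↑a⁻¹ : R) * X 1 0)) := by
  have hdet := X.det_coe
  rw [det_fin_two] at hdet
  have ha := a.mul_inv
  rw [coe_commutator_eMat, eMat_conj, Matrix.SpecialLinearGroup.coe_inv, adjugate_fin_two]
  simp only [cycMat, fPoly, gPoly, trace_fin_two, mul_apply, Fin.sum_univ_two, Matrix.sub_apply,
    of_apply, cons_val', cons_val_zero, cons_val_one, cons_val_fin_one]
  generalize (X : Matrix (Fin 2) (Fin 2) R) 0 0 = x₁ at *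
  generalize (X : Matrix (Fin 2) (Fin 2) R) 0 1 = x₂ at *
  generalize (X : Matrix (Fin 2) (Fin 2) R) 1 0 = x₃ at *
  generalize (X : Matrix (Fin 2) (Fin 2) R) 1 1 = x₄ at *
  generalize (↑a⁻¹ : R) = c at *
  generalize (a : R) = b at *
  linear_combination l * hdet + l * (x₁ * x₄ - x₂ * x₃ - x₁ ^ 2 - c * l * x₃ * x₁) * ha

end Trace

/-! ### Congruence subgroups -/

section Quotients

variable {𝔬 : Type*} [CommRing 𝔬] [IsDomain 𝔬] [IsDiscreteValuationRing 𝔬]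
  {π : 𝔬} {r : ℕ}

theorem mk_pow_self (hπ : Irreducible π) (r : ℕ) :
    (Ideal.Quotient.mk (IsLocalRing.maximalIdeal 𝔬 ^ r) π) ^ r = 0 := by
  rw [← map_pow, Ideal.Quotient.eq_zero_iff_mem, hπ.maximalIdeal_eq]
  exact Ideal.pow_mem_pow (Ideal.mem_span_singleton_self π) r

theorem red_eq_zero_iff (hπ : Irreducible π) {i : ℕ} (h : i ≤ r) (x : Oq 𝔬 r) :
    red h x = 0 ↔ Ideal.Quotient.mk _ π ^ i ∣ x := by
  constructor
  · intro hx
    obtain ⟨x, rfl⟩ := Ideal.Quotient.mk_surjective x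
    rw [red, Ideal.Quotient.factor_mk, Ideal.Quotient.eq_zero_iff_mem, hπ.maximalIdeal_eq,
      Ideal.span_singleton_pow, Ideal.mem_span_singleton] at hx
    rw [← map_pow]
    exact map_dvd _ hx
  · rintro ⟨w, rfl⟩
    rw [map_mul, map_pow, red, Ideal.Quotient.factor_mk, mk_pow_self hπ, zero_mul]

theorem mem_congM_iff {i : ℕ} (h : i ≤ r) (g : GL (Fin 2) (Oq 𝔬 r)) :
    g ∈ congM h ↔ ∀ s t, red h (((g : Matrix (Fin 2) (Fin 2) (Oq 𝔬 r)) - 1) s t) = 0 := by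
  refine ⟨fun hg => red_sub_one_of_mem_congM h hg, fun hg => ?_⟩
  change GeneralLinearGroup.map (n := Fin 2) (red h) g = 1
  ext s t
  have := hg s t
  rw [Matrix.sub_apply, map_sub, sub_eq_zero] at this
  rw [GeneralLinearGroup.map_apply, this, Units.val_one, one_apply, one_apply]
  split_ifs <;> simp

theorem toGL_mem_congM_iff {i : ℕ} (h : i ≤ r) (g : SpecialLinearGroup (Fin 2) (Oq 𝔬 r)) :
    SpecialLinearGroup.toGL g ∈ congM h ↔ g ∈ congK h := by
  refine ⟨fun hg => ?_, toGL_mem_congM h⟩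
  change SpecialLinearGroup.map (n := Fin 2) (red (𝔬 := 𝔬) h) g = 1
  have hg' : GeneralLinearGroup.map (n := Fin 2) (red (𝔬 := 𝔬) h)
      (SpecialLinearGroup.toGL g) = 1 := hg
  ext s t
  have h2 := congrArg (fun u : GL (Fin 2) (Oq 𝔬 i) => (u : Matrix (Fin 2) (Fin 2) (Oq 𝔬 i)) s t) hg'
  simpa using h2

theorem cycMat_map_red {a : (Oq 𝔬 (ell' r))ˣ} {α β : Oq 𝔬 (ell' r)}
    {a' : (Oq 𝔬 r)ˣ} {α' β' : Oq 𝔬 r}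
    (ha : red (ell'_le r) (a' : Oq 𝔬 r) = a) (hα : red (ell'_le r) α' = α)
    (hβ : red (ell'_le r) β' = β) :
    (cycMat a' α' β').map (red (ell'_le r)) = cycMat a α β := by
  have h1 : Units.map (red (𝔬 := 𝔬) (ell'_le r)).toMonoidHom a' = a := Units.ext ha
  have h2 : red (ell'_le r) (↑a'⁻¹ : Oq 𝔬 r) = (↑a⁻¹ : Oq 𝔬 (ell' r)) := by
    rw [← h1, ← map_inv]; rfl
  ext i j
  fin_cases i <;> fin_cases j <;> simp [cycMat, ha, hα, hβ, h2]

theorem psiBr_apply (ψ : AddChar (Oq 𝔬 r) ℂˣ) {A : Matrix (Fin 2) (Fin 2) (Oq 𝔬 (ell' r))}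
    {X : Matrix (Fin 2) (Fin 2) (Oq 𝔬 r)} (hX : X.map (red (ell'_le r)) = A)
    (g : congK (𝔬 := 𝔬) (ell_le r)) :
    psiBr ψ A g = ψ (trace (X *
      (((g : SpecialLinearGroup (Fin 2) (Oq 𝔬 r)) : Matrix (Fin 2) (Fin 2) (Oq 𝔬 r)) - 1))) := by
  rw [psiBr, psiA_eq_psiLift ψ _ _ hX]
  rfl

theorem mem_map_ker_psiBr_iff (ψ : AddChar (Oq 𝔬 r) ℂˣ)
    (A : Matrix (Fin 2) (Fin 2) (Oq 𝔬 (ell' r))) (g : SpecialLinearGroup (Fin 2) (Oq 𝔬 r)) :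
    g ∈ (psiBr ψ A).ker.map (congK (ell_le r)).subtype ↔
      SpecialLinearGroup.toGL g ∈ (psiA ψ A).ker.map (congM (ell_le r)).subtype := by
  constructor
  · rintro ⟨k, hk, rfl⟩
    exact ⟨⟨_, toGL_mem_congM _ k.2⟩, hk, rfl⟩
  · rintro ⟨k, hk, hkg⟩
    have hk2 := k.2
    change (k : GL (Fin 2) (Oq 𝔬 r)) = _ at hkg
    rw [hkg, toGL_mem_congM_iff] at hk2
    refine ⟨⟨g, hk2⟩, ?_, rfl⟩
    have : k = ⟨_, toGL_mem_congM _ hk2⟩ := Subtype.ext hkg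
    rwa [this] at hk

end Quotients

/-! ### The centralizer of a cyclic matrix -/

section Cyclic

variable {R : Type*} [CommRing R]

/-- A matrix commuting with a cyclic matrix `A` is a polynomial in `A`. -/
theorem eq_of_commute_cycMat {a : Rˣ} {α β : R} {g : Matrix (Fin 2) (Fin 2) R}
    (hg : Commute g (cycMat a α β)) :
    g = g 0 0 • (1 : Matrix (Fin 2) (Fin 2) R) + ((↑a⁻¹ : R) * g 1 0) • cycMat a α β := by
  have ha := a.mul_inv
  have h00 := congrFun (congrFun hg.eq 0) 0
  have h10 := congrFun (congrFun hg.eq 1) 0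
  simp [cycMat, mul_apply, Fin.sum_univ_two] at h00 h10
  ext i j
  fin_cases i <;> fin_cases j <;> simp [cycMat]
  · linear_combination (↑a⁻¹ : R) * h00 - g 0 1 * ha
  · linear_combination - g 1 0 * ha
  · linear_combination (↑a⁻¹ : R) * h10 + (g 0 0 - g 1 1) * ha

theorem commute_of_commute_cycMat {a : Rˣ} {α β : R} {g h : Matrix (Fin 2) (Fin 2) R}
    (hg : Commute g (cycMat a α β)) (hh : Commute h (cycMat a α β)) : Commute g h := by
  rw [eq_of_commute_cycMat hh]
  exact ((Commute.one_right g).smul_right _).add_right (hg.smul_right _)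

/-- Conjugation by the centralizer of `X` fixes the character `psiLift ψ X`. -/
theorem trace_mul_conj_sub_one {X : Matrix (Fin 2) (Fin 2) R} {g : GL (Fin 2) R}
    (hg : g ∈ centGL X) (m : GL (Fin 2) R) :
    trace (X * (((g * m * g⁻¹ : GL (Fin 2) R) : Matrix (Fin 2) (Fin 2) R) - 1)) =
      trace (X * ((m : Matrix (Fin 2) (Fin 2) R) - 1)) := by
  have hg' : (g : Matrix (Fin 2) (Fin 2) R) * X = X * g := hg
  have h1 : X * (((g * m * g⁻¹ : GL (Fin 2) R) : Matrix (Fin 2) (Fin 2) R) - 1) =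
      (g : Matrix (Fin 2) (Fin 2) R) * (X * ((m : Matrix (Fin 2) (Fin 2) R) - 1)) *
        ((g⁻¹ : GL (Fin 2) R) : Matrix (Fin 2) (Fin 2) R) := by
    rw [← mul_assoc, hg', Units.val_mul, Units.val_mul, mul_assoc X, mul_assoc X, mul_sub _ _ 1,
      mul_sub _ _ 1, mul_one, mul_one, sub_mul, Units.mul_inv, mul_sub, mul_one]
  rw [h1, trace_units_conj]

end Cyclic

/-! ### Commutators in `D_G^ℓ(A)` -/

section Local

variable {𝔬 : Type*} [CommRing 𝔬] [IsLocalRing 𝔬] {r : ℕ}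

instance congM_normal {i : ℕ} (h : i ≤ r) : (congM (𝔬 := 𝔬) h).Normal :=
  MonoidHom.normal_ker _

instance congK_normal {i : ℕ} (h : i ≤ r) : (congK (𝔬 := 𝔬) h).Normal :=
  MonoidHom.normal_ker _

/-- `ψ_A` is trivial on the commutators of `D_G^ℓ(A)`: both `C(A)`, which is commutative, and `M^ℓ`
fix `ψ_A` under conjugation. -/
theorem commutator_DG_le (hr : 2 ≤ r) (ψ : AddChar (Oq 𝔬 r) ℂˣ) (a : (Oq 𝔬 r)ˣ) (α β : Oq 𝔬 r) :
    ⁅DG hr (cycMat a α β), DG hr (cycMat a α β)⁆ ≤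
      (psiLift ψ (cycMat a α β)).ker.map (congM (ell_le r)).subtype := by
  set A := cycMat a α β
  set T : Set (GL (Fin 2) (Oq 𝔬 r)) :=
    ((centGL A ⊓ congM (show 1 ≤ r by omega) : Subgroup _) : Set (GL (Fin 2) (Oq 𝔬 r))) ∪
      (congM (𝔬 := 𝔬) (ell_le r) : Set (GL (Fin 2) (Oq 𝔬 r))) with hT
  have hDG : DG hr A = Subgroup.closure T := by
    rw [hT, Subgroup.closure_union, Subgroup.closure_eq, Subgroup.closure_eq, DG]
  have hnorm : ∀ t m : GL (Fin 2) (Oq 𝔬 r), m ∈ congM (𝔬 := 𝔬) (ell_le r) →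
      t * m * t⁻¹ ∈ congM (𝔬 := 𝔬) (ell_le r) := fun t m hm =>
    (congM_normal (ell_le r)).conj_mem m hm t
  -- The character is invariant under conjugation by either kind of generator.
  have hinv : ∀ t ∈ T, ∀ (m : GL (Fin 2) (Oq 𝔬 r)) (hm : m ∈ congM (𝔬 := 𝔬) (ell_le r)),
      psiLift ψ A ⟨t * m * t⁻¹, hnorm t m hm⟩ = psiLift ψ A ⟨m, hm⟩ := by
    rintro t (ht | ht) m hm
    · change ψ _ = ψ _
      rw [trace_mul_conj_sub_one ht.1 m]
    · have : (⟨t * m * t⁻¹, hnorm t m hm⟩ : congM (𝔬 := 𝔬) (ell_le r)) =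
          ⟨t, ht⟩ * ⟨m, hm⟩ * ⟨t, ht⟩⁻¹ := rfl
      rw [this, map_mul, map_mul, map_inv, mul_right_comm, mul_inv_cancel, one_mul]
  have hTM : ∀ t ∈ T, ∀ m ∈ congM (𝔬 := 𝔬) (ell_le r),
      ⁅t, m⁆ ∈ (psiLift ψ A).ker.map (congM (ell_le r)).subtype := by
    intro t ht m hm
    refine ⟨⟨t * m * t⁻¹, hnorm t m hm⟩ * ⟨m, hm⟩⁻¹, ?_, rfl⟩
    change psiLift ψ A _ = 1
    rw [map_mul, map_inv, hinv t ht m hm, mul_inv_cancel]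
  rw [hDG]
  refine commutator_closure_le (fun t ht => ?_) ?_
  · rw [SetLike.mem_coe, Subgroup.mem_normalizer_iff]
    intro n
    constructor
    · rintro ⟨⟨m, hm⟩, hk, rfl⟩
      exact ⟨⟨t * m * t⁻¹, hnorm t m hm⟩, (hinv t ht m hm).trans hk, rfl⟩
    · rintro ⟨⟨m, hm⟩, hk, hmn⟩
      change m = _ at hmn
      have hn : n ∈ congM (𝔬 := 𝔬) (ell_le r) := by
        have := hnorm t⁻¹ m hm
        rw [hmn] at this
        simpa [mul_assoc] using this
      refine ⟨⟨n, hn⟩, ?_, rfl⟩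
      change psiLift ψ A _ = 1
      rw [← hinv t ht n hn]
      have : (⟨t * n * t⁻¹, hnorm t n hn⟩ : congM (𝔬 := 𝔬) (ell_le r)) = ⟨m, hm⟩ :=
        Subtype.ext hmn.symm
      rw [this]
      exact hk
  · rintro s (hs | hs) t (ht | ht)
    · have : ⁅s, t⁆ = 1 := by
        rw [commutatorElement_eq_one_iff_mul_comm]
        exact Units.ext (commute_of_commute_cycMat hs.1 ht.1).eq
      rw [this]
      exact one_mem _
    · exact hTM s (Or.inl hs) t ht
    · rw [← commutatorElement_inv]
      exact inv_mem (hTM t (Or.inl ht) s hs)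
    · exact hTM s (Or.inr hs) t ht

end Local

/-! ### The elements of `D_S^ℓ(A)` and their commutators with `e_l` -/

section Quotients

variable {𝔬 : Type*} [CommRing 𝔬] [IsDomain 𝔬] [IsDiscreteValuationRing 𝔬]
  {π : 𝔬} {r : ℕ}

theorem congK_le_DS (hr : 2 ≤ r) (X : Matrix (Fin 2) (Fin 2) (Oq 𝔬 r)) :
    congK (ell_le r) ≤ DS hr X := fun _ hg =>
  (le_sup_right : _ ≤ DG hr X) (toGL_mem_congM _ hg)

/-- `X ∈ D_S^ℓ(A)` iff `X` is congruent modulo `π ^ ℓ` to a matrix `x + y A` that is `≡ 1` modulo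
`π`; the parameters `x` and `y` can be read off from the first column of `X`. -/
theorem mem_DS_iff (hπ : Irreducible π) (hr : 2 ≤ r) (a : (Oq 𝔬 r)ˣ) (α β : Oq 𝔬 r)
    (X : SpecialLinearGroup (Fin 2) (Oq 𝔬 r)) :
    X ∈ DS hr (cycMat a α β) ↔ Ideal.Quotient.mk _ π ∣ X 0 0 - 1 ∧ Ideal.Quotient.mk _ π ∣ X 1 0 ∧
      Ideal.Quotient.mk _ π ^ ell r ∣ X 0 1 - (↑a⁻¹ : Oq 𝔬 r) ^ 2 * α * X 1 0 ∧
      Ideal.Quotient.mk _ π ^ ell r ∣ X 1 1 - X 0 0 - (↑a⁻¹ : Oq 𝔬 r) * β * X 1 0 := by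
  have hl : 1 ≤ ell r := by unfold ell; omega
  have ha := a.mul_inv
  have h1r : 1 ≤ r := by omega
  constructor
  · intro hX
    obtain ⟨c, ⟨hc, hc1⟩, m, hm, hcm⟩ := Subgroup.mem_sup_of_normal_right.1
      (show SpecialLinearGroup.toGL X ∈ _ ⊔ _ from hX)
    have hXc : ∀ i j, Ideal.Quotient.mk _ π ^ ell r ∣ X i j - c i j := by
      intro i j
      have h1 : (X : Matrix (Fin 2) (Fin 2) (Oq 𝔬 r)) - (c : Matrix (Fin 2) (Fin 2) (Oq 𝔬 r)) =
          (c : Matrix (Fin 2) (Fin 2) (Oq 𝔬 r)) * ((m : Matrix (Fin 2) (Fin 2) (Oq 𝔬 r)) - 1) := by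
        rw [mul_sub, mul_one, ← Units.val_mul, hcm]; rfl
      have h2 := congrFun (congrFun h1 i) j
      rw [Matrix.sub_apply, mul_apply] at h2
      rw [h2]
      exact Finset.dvd_sum fun k _ => Dvd.dvd.mul_left
        ((red_eq_zero_iff hπ _ _).1 ((mem_congM_iff _ m).1 hm k j)) _
    have hc1' : ∀ i j, Ideal.Quotient.mk _ π ∣ ((c : Matrix (Fin 2) (Fin 2) (Oq 𝔬 r)) - 1) i j := by
      intro i j
      simpa using (red_eq_zero_iff hπ _ _).1 ((mem_congM_iff _ c).1 hc1 i j)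
    have hpow : Ideal.Quotient.mk (IsLocalRing.maximalIdeal 𝔬 ^ r) π ∣
      Ideal.Quotient.mk _ π ^ ell r := dvd_pow_self _ (by omega)
    have hcA := eq_of_commute_cycMat hc
    have h01 := congrFun (congrFun hcA 0) 1
    have h11 := congrFun (congrFun hcA 1) 1
    simp [cycMat] at h01 h11
    refine ⟨?_, ?_, ?_, ?_⟩
    · have := dvd_add (hpow.trans (hXc 0 0)) (hc1' 0 0)
      simpa using this
    · have := dvd_add (hpow.trans (hXc 1 0)) (hc1' 1 0)
      simpa using this
    · convert dvd_sub (hXc 0 1) ((hXc 1 0).mul_left ((↑a⁻¹ : Oq 𝔬 r) ^ 2 * α)) using 1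
      linear_combination h01
    · convert dvd_sub (dvd_sub (hXc 1 1) (hXc 0 0))
        ((hXc 1 0).mul_left ((↑a⁻¹ : Oq 𝔬 r) * β)) using 1
      linear_combination h11
  · rintro ⟨h1, h2, h3, h4⟩
    have hdet := X.det_coe
    rw [det_fin_two] at hdet
    have hpp : Ideal.Quotient.mk (IsLocalRing.maximalIdeal 𝔬 ^ r) π ^ ell r *
        Ideal.Quotient.mk _ π ^ ell r = 0 := by
      rw [← pow_add]
      exact pow_eq_zero_of_le (le_ell_add_ell r) (mk_pow_self hπ r)
    -- The truncation of `X` to a polynomial in `A` has determinant `1` modulo `π ^ ℓ`.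
    let Z : Matrix (Fin 2) (Fin 2) (Oq 𝔬 r) :=
      !![X 0 0, (↑a⁻¹ : Oq 𝔬 r) ^ 2 * α * X 1 0; X 1 0, X 0 0 + (↑a⁻¹ : Oq 𝔬 r) * β * X 1 0]
    have hZ : IsUnit Z.det := by
      obtain ⟨u, hu⟩ := h3
      obtain ⟨v, hv⟩ := h4
      rw [det_fin_two]
      simp only [Z, of_apply, cons_val', cons_val_zero, cons_val_one, cons_val_fin_one]
      refine IsUnit.of_mul_eq_one
        (1 + Ideal.Quotient.mk _ π ^ ell r * (X 0 0 * v - u * X 1 0)) ?_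
      linear_combination (hdet - X 0 0 * hv + X 1 0 * hu) *
        (1 + Ideal.Quotient.mk _ π ^ ell r * (X 0 0 * v - u * X 1 0)) -
        (X 0 0 * v - u * X 1 0) ^ 2 * hpp
    let c : GL (Fin 2) (Oq 𝔬 r) := GeneralLinearGroup.mk'' Z hZ
    have hc : c ∈ centGL (cycMat a α β) := by
      change Z * _ = _ * Z
      ext i j
      fin_cases i <;> fin_cases j <;> simp [Z, cycMat, mul_apply, Fin.sum_univ_two]
      · linear_combination (↑a⁻¹ : Oq 𝔬 r) * α * X 1 0 * ha
      · ring
      · linear_combination β * X 1 0 * ha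
      · linear_combination - (↑a⁻¹ : Oq 𝔬 r) * α * X 1 0 * ha
    have hc1 : c ∈ congM h1r := by
      rw [mem_congM_iff]
      intro i j
      rw [red_eq_zero_iff hπ, pow_one]
      change _ ∣ (Z - 1) i j
      fin_cases i <;> fin_cases j <;> simp [Z]
      · exact h1
      · exact h2.mul_left _
      · exact h2
      · rw [add_sub_right_comm]
        exact dvd_add h1 (h2.mul_left _)
    have hm : c⁻¹ * SpecialLinearGroup.toGL X ∈ congM (𝔬 := 𝔬) (ell_le r) := by
      refine (MonoidHom.eq_iff _).1 ?_
      ext i j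
      rw [GeneralLinearGroup.map_apply, GeneralLinearGroup.map_apply, ← sub_eq_zero, ← map_sub,
        red_eq_zero_iff hπ]
      change _ ∣ X i j - Z i j
      fin_cases i <;> fin_cases j <;> simp [Z]
      · exact h3
      · rwa [← sub_sub]
    have : SpecialLinearGroup.toGL X = c * (c⁻¹ * SpecialLinearGroup.toGL X) := by group
    change SpecialLinearGroup.toGL X ∈ DG hr _
    rw [this]
    exact Subgroup.mul_mem_sup ⟨hc, hc1⟩ hm

end Quotients

section Normalizer

variable {R : Type*} [CommRing R]

theorem eMat_inv (a : Rˣ) (x : R) : (eMat a x)⁻¹ = eMat a (-x) := by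
  ext i j
  rw [Matrix.SpecialLinearGroup.coe_inv, adjugate_fin_two]
  fin_cases i <;> fin_cases j <;> simp [eMat]

theorem neg_mem_hSet {ϖ β x : R} {i : ℕ} (hx : x ∈ hSet ϖ β i) : -x ∈ hSet ϖ β i := by
  refine ⟨by simpa using hx.1, ?_⟩
  have : -x * (-x + β) = x * (2 * x) - x * (x + β) := by ring
  rw [this]
  exact sub_mem (Ideal.mul_mem_left _ _ hx.1) hx.2

end Normalizer

section Quotients

variable {𝔬 : Type*} [CommRing 𝔬] [IsDomain 𝔬] [IsDiscreteValuationRing 𝔬]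
  {π : 𝔬} {r : ℕ}

/-- Since `ℓ ≤ ℓ' + 1`, one factor `π` lifts a congruence modulo `π ^ ℓ'` to one modulo `π ^ ℓ`. -/
theorem pow_ell_dvd_of_dvd {ϖ y z : Oq 𝔬 r} (hy : ϖ ∣ y) (hz : ϖ ^ ell' r ∣ z) :
    ϖ ^ ell r ∣ z * y :=
  (pow_dvd_pow ϖ (show ell r ≤ ell' r + 1 by unfold ell ell'; omega)).trans
    (pow_succ ϖ _ ▸ mul_dvd_mul hz hy)

theorem eMat_conj_mem_DS (hπ : Irreducible π) (hr : 2 ≤ r) (a : (Oq 𝔬 r)ˣ) (α β : Oq 𝔬 r)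
    {l : Oq 𝔬 r} (hl : l ∈ hSet (Ideal.Quotient.mk _ π) β (ell' r))
    {X : SpecialLinearGroup (Fin 2) (Oq 𝔬 r)} (hX : X ∈ DS hr (cycMat a α β)) :
    eMat a l * X * (eMat a l)⁻¹ ∈ DS hr (cycMat a α β) := by
  rw [mem_DS_iff hπ] at hX ⊢
  obtain ⟨h1, h2, h3, h4⟩ := hX
  have hl1 := pow_ell_dvd_of_dvd h2 (Ideal.mem_span_singleton.1 hl.1)
  have hl2 := pow_ell_dvd_of_dvd h2 (Ideal.mem_span_singleton.1 hl.2)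
  rw [eMat_conj]
  simp only [of_apply, cons_val', cons_val_zero, cons_val_one, cons_val_fin_one]
  refine ⟨?_, h2, ?_, ?_⟩
  · rw [add_sub_right_comm]
    exact dvd_add h1 (h2.mul_left _)
  · -- Modulo `π ^ ℓ` this is a multiple of `l (β - l) y = β (2 l) y - l (l + β) y`.
    convert dvd_add (dvd_add h3 (h4.mul_left ((↑a⁻¹ : Oq 𝔬 r) * l)))
      ((dvd_sub (hl1.mul_left β) hl2).mul_left ((↑a⁻¹ : Oq 𝔬 r) ^ 2)) using 1
    ring
  · convert dvd_sub h4 (hl1.mul_left (↑a⁻¹ : Oq 𝔬 r)) using 1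
    ring

theorem eMat_mem_normalizer_DS (hπ : Irreducible π) (hr : 2 ≤ r) (a : (Oq 𝔬 r)ˣ) (α β : Oq 𝔬 r)
    {l : Oq 𝔬 r} (hl : l ∈ hSet (Ideal.Quotient.mk _ π) β (ell' r)) :
    eMat a l ∈ Subgroup.normalizer
      (DS hr (cycMat a α β) : Set (SpecialLinearGroup (Fin 2) (Oq 𝔬 r))) := by
  rw [Subgroup.mem_normalizer_iff]
  refine fun X => ⟨eMat_conj_mem_DS hπ hr a α β hl, fun hX => ?_⟩
  have := eMat_conj_mem_DS hπ hr a α β (neg_mem_hSet hl) hX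
  rw [← eMat_inv] at this
  simpa [mul_assoc] using this

/-- The diagonal entries of `e_l X e_l⁻¹ - X` are `± l y`, where `y = a⁻¹ X₁₀`, and modulo `π ^ ℓ` the
other two are multiples of `l y`. -/
theorem commutator_eMat_mem_congK_iff (hπ : Irreducible π) (hr : 2 ≤ r) (a : (Oq 𝔬 r)ˣ)
    (α β l : Oq 𝔬 r) {X : SpecialLinearGroup (Fin 2) (Oq 𝔬 r)} (hX : X ∈ DS hr (cycMat a α β)) :
    ⁅eMat a l, X⁆ ∈ congK (𝔬 := 𝔬) (ell_le r) ↔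
      Ideal.Quotient.mk _ π ^ ell r ∣ l * ((↑a⁻¹ : Oq 𝔬 r) * X 1 0) := by
  obtain ⟨-, -, -, h4⟩ := (mem_DS_iff hπ hr a α β X).1 hX
  have h : ⁅eMat a l, X⁆ ∈ congK (𝔬 := 𝔬) (ell_le r) ↔ ∀ i j, Ideal.Quotient.mk _ π ^ ell r ∣
      ((eMat a l * X * (eMat a l)⁻¹ : SpecialLinearGroup (Fin 2) (Oq 𝔬 r)) :
        Matrix (Fin 2) (Fin 2) (Oq 𝔬 r)) i j - X i j := by
    rw [commutatorElement_def, congK, MonoidHom.mem_ker, map_mul, map_inv, mul_inv_eq_one,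
      Matrix.SpecialLinearGroup.ext_iff]
    refine forall_congr' fun i => forall_congr' fun j => ?_
    rw [← red_eq_zero_iff hπ (ell_le r), map_sub, sub_eq_zero]
    rfl
  rw [h, eMat_conj]
  constructor
  · intro h
    convert h 0 0 using 1
    simp
    ring
  · intro h i j
    fin_cases i <;> fin_cases j <;> simp
    · convert h using 1
      ring
    · convert dvd_add (h4.mul_left ((↑a⁻¹ : Oq 𝔬 r) * l))
        (h.mul_left ((↑a⁻¹ : Oq 𝔬 r) * (β - l))) using 1
      ring
    · convert h using 1
      ring

theorem dvd_gPoly_sub_one (hπ : Irreducible π) (hr : 2 ≤ r) (a : (Oq 𝔬 r)ˣ) (α β : Oq 𝔬 r)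
    {X : SpecialLinearGroup (Fin 2) (Oq 𝔬 r)} (hX : X ∈ DS hr (cycMat a α β)) :
    Ideal.Quotient.mk _ π ^ ell r ∣ gPoly α β (X 0 0) ((↑a⁻¹ : Oq 𝔬 r) * X 1 0) - 1 := by
  obtain ⟨-, -, h3, h4⟩ := (mem_DS_iff hπ hr a α β X).1 hX
  have hdet := X.det_coe
  rw [det_fin_two] at hdet
  convert dvd_sub (h3.mul_right (X 1 0)) (h4.mul_left (X 0 0)) using 1
  rw [gPoly]
  linear_combination hdet

/-- The points `(x, y)` with `x ≡ 1` modulo `π` are realized by elements of `D_S^ℓ(A)`: complete the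
first column of `x + y A` to a matrix of determinant `1`. -/
theorem exists_mem_DS (hπ : Irreducible π) (hr : 2 ≤ r) (a : (Oq 𝔬 r)ˣ) (α β : Oq 𝔬 r)
    {x y : Oq 𝔬 r} (hx : Ideal.Quotient.mk _ π ∣ x - 1) (hy : Ideal.Quotient.mk _ π ∣ y)
    (hg : Ideal.Quotient.mk _ π ^ ell r ∣ gPoly α β x y - 1) :
    ∃ X ∈ DS hr (cycMat a α β), X 0 0 = x ∧ (↑a⁻¹ : Oq 𝔬 r) * X 1 0 = y := by
  have ha := a.mul_inv
  have hxu : IsUnit x := by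
    obtain ⟨w, hw⟩ := hx
    rw [sub_eq_iff_eq_add'.1 hw]
    refine IsNilpotent.isUnit_one_add ⟨r, ?_⟩
    rw [mul_pow, mk_pow_self hπ, zero_mul]
  obtain ⟨x', hx'⟩ := hxu.exists_right_inv
  refine ⟨⟨!![x, (↑a⁻¹ : Oq 𝔬 r) * α * y; a * y, x' * (1 + α * y ^ 2)], ?_⟩, ?_, rfl, ?_⟩
  · rw [det_fin_two]
    simp only [of_apply, cons_val', cons_val_zero, cons_val_one, cons_val_fin_one]
    linear_combination (1 + α * y ^ 2) * hx' - α * y ^ 2 * ha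
  · refine (mem_DS_iff hπ hr a α β _).2 ⟨hx, hy.mul_left _, ⟨0, ?_⟩, ?_⟩
    · change (↑a⁻¹ : Oq 𝔬 r) * α * y - (↑a⁻¹ : Oq 𝔬 r) ^ 2 * α * (a * y) = _
      linear_combination - (↑a⁻¹ : Oq 𝔬 r) * α * y * ha
    · change _ ∣ x' * (1 + α * y ^ 2) - x - (↑a⁻¹ : Oq 𝔬 r) * β * (a * y)
      convert hg.mul_left (-x') using 1
      rw [gPoly]
      linear_combination (- β * y) * ha + (x + β * y) * hx'
  · change (↑a⁻¹ : Oq 𝔬 r) * (a * y) = y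
    rw [← mul_assoc, a.inv_mul, one_mul]

theorem dvd_or_dvd_of_dvd_mul (hπ : Irreducible π) (hr : r ≠ 0) {x y : Oq 𝔬 r}
    (h : Ideal.Quotient.mk _ π ∣ x * y) :
    Ideal.Quotient.mk _ π ∣ x ∨ Ideal.Quotient.mk _ π ∣ y := by
  obtain ⟨x, rfl⟩ := Ideal.Quotient.mk_surjective x
  obtain ⟨y, rfl⟩ := Ideal.Quotient.mk_surjective y
  obtain ⟨w, hw⟩ := h
  obtain ⟨w, rfl⟩ := Ideal.Quotient.mk_surjective w
  rw [← map_mul, ← map_mul, Ideal.Quotient.eq] at hw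
  have h1 := Ideal.pow_le_self hr hw
  rw [hπ.maximalIdeal_eq, Ideal.mem_span_singleton] at h1
  have h2 : π ∣ x * y := (dvd_sub_left (dvd_mul_right π w)).1 h1
  exact (hπ.prime.dvd_or_dvd h2).imp (map_dvd _) (map_dvd _)

/-- The correction `2 l (1 - g(x, y))` in the trace formula vanishes for `X ∈ D_S^ℓ(A)` and
`l ∈ h^{ℓ'}`, as a multiple of `π ^ (ℓ' + ℓ) = 0`. -/
theorem trace_commutator_eq_fPoly (hπ : Irreducible π) (hr : 2 ≤ r) (a : (Oq 𝔬 r)ˣ)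
    (α β : Oq 𝔬 r) {l : Oq 𝔬 r} (hl : l ∈ hSet (Ideal.Quotient.mk _ π) β (ell' r))
    {X : SpecialLinearGroup (Fin 2) (Oq 𝔬 r)} (hX : X ∈ DS hr (cycMat a α β)) :
    trace (cycMat a α β * (((⁅eMat a l, X⁆ : SpecialLinearGroup (Fin 2) (Oq 𝔬 r)) :
      Matrix (Fin 2) (Fin 2) (Oq 𝔬 r)) - 1)) =
      fPoly α β l (X 0 0) ((↑a⁻¹ : Oq 𝔬 r) * X 1 0) := by
  obtain ⟨u, hu⟩ := dvd_gPoly_sub_one hπ hr a α β hX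
  obtain ⟨s, hs⟩ := Ideal.mem_span_singleton.1 hl.1
  have hpq : Ideal.Quotient.mk (IsLocalRing.maximalIdeal 𝔬 ^ r) π ^ ell' r *
      Ideal.Quotient.mk _ π ^ ell r = 0 := by
    rw [← pow_add]
    exact pow_eq_zero_of_le (le_ell'_add_ell r) (mk_pow_self hπ r)
  rw [trace_cycMat_mul_commutator, hs]
  linear_combination - (Ideal.Quotient.mk _ π ^ ell' r * s) * hu - s * u * hpq

end Quotients

end SLTwoExt

open SLTwoExt
open scoped commutatorElement
theorem mainTheorem6 {𝔬 : Type*} [CommRing 𝔬] [IsDomain 𝔬] [IsDiscreteValuationRing 𝔬]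
    [IsAdicComplete (IsLocalRing.maximalIdeal 𝔬) 𝔬] [Finite (IsLocalRing.ResidueField 𝔬)]
    (π : 𝔬) (hπ : Irreducible π) (r : ℕ) (hr : 2 ≤ r)
    (ψ : AddChar (Oq 𝔬 r) ℂˣ) (hψ : ψ (Ideal.Quotient.mk _ π ^ (r - 1)) ≠ 1)
    (a : (Oq 𝔬 (ell' r))ˣ) (α β : Oq 𝔬 (ell' r))
    (a' : (Oq 𝔬 r)ˣ) (α' β' : Oq 𝔬 r)
    (ha : red (ell'_le r) (a' : Oq 𝔬 r) = a) (hα : red (ell'_le r) α' = α)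
    (hβ : red (ell'_le r) β' = β)
    (l : Oq 𝔬 r) (hl : l ∈ hSet (Ideal.Quotient.mk _ π) β' (ell' r)) :
    List.TFAE [
      ESet (Ideal.Quotient.mk _ π) α' β' (ell r) l =
        ESetCirc ψ (Ideal.Quotient.mk _ π) α' β' (ell r) l,
      ∀ X ∈ DS hr (cycMat a' α' β'), ∀ h : ⁅eMat a' l, X⁆ ∈ congK (ell_le r),
        (⟨⁅eMat a' l, X⁆, h⟩ : congK (𝔬 := 𝔬) (ell_le r)) ∈ (psiBr ψ (cycMat a α β)).ker,
      ⁅Subgroup.zpowers (eMat a' l), DS hr (cycMat a' α' β')⁆ ⊓ congK (ell_le r) ≤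
        (psiBr ψ (cycMat a α β)).ker.map (congK (ell_le r)).subtype,
      l ∈ EExt hr ψ (Ideal.Quotient.mk _ π) (cycMat a α β) a' α' β',
      ExtendsTo (psiBr ψ (cycMat a α β)) (DSgen hr (cycMat a' α' β') (eMat a' l))] := by
  have hA := cycMat_map_red ha hα hβ
  have hval : ∀ X ∈ DS hr (cycMat a' α' β'), ∀ h : ⁅eMat a' l, X⁆ ∈ congK (ell_le r),
      (⟨⁅eMat a' l, X⁆, h⟩ : congK (𝔬 := 𝔬) (ell_le r)) ∈ (psiBr ψ (cycMat a α β)).ker ↔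
        ψ (fPoly α' β' l (X 0 0) ((↑a'⁻¹ : Oq 𝔬 r) * X 1 0)) = 1 := by
    intro X hX h
    rw [MonoidHom.mem_ker, psiBr_apply ψ hA,
      trace_commutator_eq_fPoly hπ hr a' α' β' hl hX]
  tfae_have 1 → 2 := by
    intro H X hX h
    have hX' := (mem_DS_iff hπ hr a' α' β' X).1 hX
    have hmem : (X 0 0, (↑a'⁻¹ : Oq 𝔬 r) * X 1 0) ∈
        ESet (Ideal.Quotient.mk _ π) α' β' (ell r) l :=
      ⟨Ideal.mem_span_singleton.2 (hX'.2.1.mul_left _),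
        Ideal.mem_span_singleton.2 (dvd_gPoly_sub_one hπ hr a' α' β' hX),
        Ideal.mem_span_singleton.2
          ((commutator_eMat_mem_congK_iff hπ hr a' α' β' l hX).1 h)⟩
    rw [H] at hmem
    exact (hval X hX h).2 hmem.2
  tfae_have 2 → 1 := by
    intro H
    refine Set.Subset.antisymm (fun p hp => ⟨hp, ?_⟩) fun p hp => hp.1
    obtain ⟨x, y⟩ := p
    obtain ⟨hy, hg, hly⟩ := hp
    simp only [Ideal.mem_span_singleton] at hy hg hly
    have key : ∀ x y : Oq 𝔬 r, Ideal.Quotient.mk _ π ∣ x - 1 → Ideal.Quotient.mk _ π ∣ y →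
        Ideal.Quotient.mk _ π ^ ell r ∣ gPoly α' β' x y - 1 →
        Ideal.Quotient.mk _ π ^ ell r ∣ l * y → ψ (fPoly α' β' l x y) = 1 := by
      intro x y hx hy hg hly
      obtain ⟨X, hX, rfl, rfl⟩ := exists_mem_DS hπ hr a' α' β' hx hy hg
      have h := (commutator_eMat_mem_congK_iff hπ hr a' α' β' l hX).2 hly
      exact (hval X hX h).1 (H X hX h)
    have hxx : Ideal.Quotient.mk _ π ∣ (x - 1) * (x + 1) := by
      have h1 : Ideal.Quotient.mk _ π ∣ gPoly α' β' x y - 1 :=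
        (dvd_pow_self _ (by unfold ell; omega)).trans hg
      convert dvd_sub h1 (hy.mul_left (β' * x - α' * y)) using 1
      rw [gPoly]
      ring
    change ψ (fPoly α' β' l x y) = 1
    -- `f` and `g` are even in `(x, y)`, so one may assume `x ≡ 1` modulo `π`.
    rcases dvd_or_dvd_of_dvd_mul hπ (by omega) hxx with hx | hx
    · exact key x y hx hy hg hly
    · have h1 : fPoly α' β' l x y = fPoly α' β' l (-x) (-y) := by unfold fPoly; ring
      rw [h1]
      refine key (-x) (-y) ?_ hy.neg_right ?_ ?_
      · rw [← neg_add', dvd_neg]; exact hx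
      · convert hg using 1
        unfold gPoly
        ring
      · rw [mul_neg, dvd_neg]; exact hly
  tfae_have 5 → 3 := fun h => commutator_inf_le_of_extendsTo h le_sup_left le_sup_right
  tfae_have 3 → 2 := by
    intro H X hX h
    obtain ⟨k, hk, hkX⟩ := H ⟨Subgroup.commutator_mem_commutator (Subgroup.mem_zpowers _) hX, h⟩
    have : k = ⟨_, h⟩ := Subtype.ext hkX
    rwa [this] at hk
  tfae_have 2 → 5 := by
    intro H
    have : Finite (𝔬 ⧸ IsLocalRing.maximalIdeal 𝔬) :=
      inferInstanceAs (Finite (IsLocalRing.ResidueField 𝔬))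
    have : Finite (Oq 𝔬 r) := Ideal.finite_quotient_pow (IsNoetherian.noetherian _) r
    refine extendsTo_sup_zpowers (congK_le_DS hr _) _
      (eMat_mem_normalizer_DS hπ hr a' α' β' hl) ?_ fun X hX h => ⟨_, H X hX h, rfl⟩
    rw [Subgroup.commutator_le]
    intro X hX Y hY
    rw [mem_map_ker_psiBr_iff, map_commutatorElement, psiA_eq_psiLift ψ _ _ hA]
    exact commutator_DG_le hr ψ a' α' β' (Subgroup.commutator_mem_commutator hX hY)
  tfae_have 4 → 5 := fun h => h.2.2
  tfae_have 5 → 4 := fun h => ⟨hl, ⟨l, hl, rfl⟩, h⟩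
  tfae_finish
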